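/- **Setting.** A lattice path is a finite sequence of points of $\mathbb Z^2$ in which consecutive points are at distance $1$ (points may repeat); it is $x$-monotone if it never steps to the left. Let $m>0$ be an integer, and let $\eta_-,\eta_+$ be two $x$-monotone lattice paths, each going from the line $\{x=0\}$ to the line $\{x=m\}$, with $\eta_-$ weakly below $\eta_+$: for each $0\le i<m$ the horizontal step of $\eta_-$ from $x=i$ to $x=i+1$ is not higher than that of $\eta_+$; no point of $\eta_-$ is above all points of $\eta_+$ on the same vertical line; and no point of $\eta_+$ is below all points of $\eta_-$ on the same vertical line. Let $\Gamma$ be the closed (simply connected) region enclosed by $\eta_-$, $\eta_+$ and the lines $x=0$ and $x=m$. Thus its lattice points are the $(i,j)$ for which there are points $(i,y)$ of $\eta_-$ and $(i,y')$ of $\eta_+$ with $y\le j\le y'$; a vertical unit segment lies in $\Gamma$ if its endpoints do; and the horizontal unit segment from $(i,j)$ to $(i+1,j)$ lies in $\Gamma$ if $j$ is between the heights (inclusive) of the horizontal steps of $\eta_-$ and $\eta_+$ from $x=i$ to $x=i+1$. Let $\alpha=\Gamma\cap\{x=0\}$ and $\beta=\Gamma\cap\{x=m\}$ be the two vertical sides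 of $\Gamma$, regarded as sets of lattice points. **Theorem 1.1.** Suppose that the origin $O=(0,0)$ lies in $\alpha$. Let $\{X_t\}_{t\ge0}$ be the simple nearest-neighbour random walk on $\mathbb Z^2$ (independent steps, each of the four unit steps having probability $\tfrac14$) which starts at $X_0=O$ and is absorbed (killed) whenever it tries to make a step along a unit segment that does not lie in $\Gamma$. Let $T$ be the first time $t$ such that $X_t\in\beta$ ($T=\infty$ if there is none), and let $p(k)$ be the probability that $T<\infty$ and $X_T=(m,k)$. Then $$p(k)^2\ \ge\ p(k+1)\,p(k-1)\qquad\text{for all } k\in\mathbb Z \text{ such that } (m,k+1)\in\beta \text{ and } (m,k-1)\in\beta .$$ -/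

import Mathlib

open MeasureTheory ProbabilityTheory

/-- Two points of `ℤ²` are nearest neighbours if they are at distance one. -/
def NearestNeighbor (P Q : ℤ × ℤ) : Prop :=
  |P.1 - Q.1| + |P.2 - Q.2| = 1

/-- A lattice path `pt 0, pt 1, …, pt len` in `ℤ²`; it may visit a point more than once.
The values of `pt` beyond `len` carry no meaning. -/
structure LatticePath where
  len : ℕ
  pt : ℕ → ℤ × ℤ
  step : ∀ s < len, NearestNeighbor (pt s) (pt (s + 1))

namespace LatticePath

/-- The path passes through the lattice point `P`. -/
def Visits (η : LatticePath) (P : ℤ × ℤ) : Prop :=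
  ∃ s ≤ η.len, η.pt s = P

/-- The path makes the horizontal step `(i, y) → (i + 1, y)`. -/
def HasHorizontalStep (η : LatticePath) (i y : ℤ) : Prop :=
  ∃ s < η.len, η.pt s = (i, y) ∧ η.pt (s + 1) = (i + 1, y)

/-- The path never steps to the left. -/
def XMonotone (η : LatticePath) : Prop :=
  ∀ s < η.len, (η.pt s).1 ≤ (η.pt (s + 1)).1

end LatticePath

/-- The closed region enclosed by two `x`-monotone lattice paths `lower` and `upper`, both going
from the line `x = 0` to the line `x = m`, and by two vertical intervals on these lines.
The two paths may touch, but they do not cross. -/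
structure LatticeRegion (m : ℕ) where
  lower : LatticePath
  upper : LatticePath
  lower_mono : lower.XMonotone
  upper_mono : upper.XMonotone
  lower_start : (lower.pt 0).1 = 0
  upper_start : (upper.pt 0).1 = 0
  lower_end : (lower.pt lower.len).1 = m
  upper_end : (upper.pt upper.len).1 = m
  /-- Between any two consecutive vertical lines, `lower` is not above `upper`. -/
  step_le : ∀ i y y' : ℤ, lower.HasHorizontalStep i y → upper.HasHorizontalStep i y' → y ≤ y'
  /-- No point of `lower` is above all points of `upper` on its vertical line. -/
  lower_le : ∀ i y : ℤ, lower.Visits (i, y) → ∃ y' : ℤ, y ≤ y' ∧ upper.Visits (i, y')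
  /-- No point of `upper` is below all points of `lower` on its vertical line. -/
  le_upper : ∀ i y' : ℤ, upper.Visits (i, y') → ∃ y : ℤ, y ≤ y' ∧ lower.Visits (i, y)

namespace LatticeRegion

variable {m : ℕ}

/-- The lattice points of the region: those on or above `lower` and on or below `upper`. -/
def points (Γ : LatticeRegion m) : Set (ℤ × ℤ) :=
  {P | (∃ y : ℤ, y ≤ P.2 ∧ Γ.lower.Visits (P.1, y)) ∧
       (∃ y' : ℤ, P.2 ≤ y' ∧ Γ.upper.Visits (P.1, y'))}

/-- The left side of the region, on the line `x = 0`. -/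
def α (Γ : LatticeRegion m) : Set (ℤ × ℤ) :=
  {P | P ∈ Γ.points ∧ P.1 = 0}

/-- The right side of the region, on the line `x = m`. -/
def β (Γ : LatticeRegion m) : Set (ℤ × ℤ) :=
  {P | P ∈ Γ.points ∧ P.1 = m}

/-- The horizontal unit segment from `(i, j)` to `(i + 1, j)` lies in the closed region. -/
def ContainsHorizontalEdge (Γ : LatticeRegion m) (i j : ℤ) : Prop :=
  (∃ y : ℤ, y ≤ j ∧ Γ.lower.HasHorizontalStep i y) ∧
  (∃ y' : ℤ, j ≤ y' ∧ Γ.upper.HasHorizontalStep i y')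

/-- The step from `P` to a nearest neighbour `Q` stays inside the region: both its endpoints and
the unit segment between them are in the region. (The points of the region on a vertical line form
an interval, so that for a vertical step the endpoints suffice.) -/
def StepInside (Γ : LatticeRegion m) (P Q : ℤ × ℤ) : Prop :=
  P ∈ Γ.points ∧ Q ∈ Γ.points ∧
    (P.1 ≠ Q.1 → Γ.ContainsHorizontalEdge (min P.1 Q.1) P.2)

open Classical in
/-- The walk from the origin with successive increments `ξ 0, ξ 1, …`, which is absorbed
(sent to the cemetery state `none`) as soon as it tries to make a step that leaves the region. -/
noncomputable def absorbedWalk (Γ : LatticeRegion m) (ξ : ℕ → ℤ × ℤ) : ℕ → Option (ℤ × ℤ)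
  | 0 => some (0, 0)
  | t + 1 =>
    match absorbedWalk Γ ξ t with
    | none => none
    | some P => if Γ.StepInside P (P + ξ t) then some (P + ξ t) else none

/-- The walk is in `β` at time `t`. -/
def InβAt (Γ : LatticeRegion m) (ξ : ℕ → ℤ × ℤ) (t : ℕ) : Prop :=
  ∃ P ∈ Γ.β, Γ.absorbedWalk ξ t = some P

/-- `T` is the first time at which the absorbed walk is in `β`. -/
def IsFirstTime (Γ : LatticeRegion m) (ξ : ℕ → ℤ × ℤ) (T : ℕ) : Prop :=
  Γ.InβAt ξ T ∧ ∀ t < T, ¬ Γ.InβAt ξ t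

/-- The exit probability `p(k)`: the probability that the absorbed walk with random increments `ξ`
reaches `β`, and that it is at the point `(m, k)` at the first time `T` when it does so. -/
noncomputable def exitProb (Γ : LatticeRegion m) {Ω : Type*} [MeasurableSpace Ω]
    (μ : Measure Ω) (ξ : ℕ → Ω → ℤ × ℤ) (k : ℤ) : ℝ :=
  μ.real {ω | ∃ T : ℕ, Γ.IsFirstTime (fun t => ξ t ω) T ∧
    Γ.absorbedWalk (fun t => ξ t ω) T = some ((m : ℤ), k)}

end LatticeRegion

/-- The increments of the simple nearest-neighbour random walk on `ℤ²`: independent random vectors,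
each uniformly distributed on the four unit vectors. -/
structure IsSimpleWalkIncrements {Ω : Type*} [MeasurableSpace Ω]
    (μ : Measure Ω) (ξ : ℕ → Ω → ℤ × ℤ) : Prop where
  measurable : ∀ t, Measurable (ξ t)
  indep : iIndepFun ξ μ
  uniform : ∀ t, ∀ e : ℤ × ℤ, NearestNeighbor (0, 0) e → μ (ξ t ⁻¹' {e}) = 1 / 4

/-!
The exit distribution `p` is compared with its translate `k ↦ p (k - 1)`, the exit distribution of
the translated region `Γ + (0, 1)` from the point `(0, 1)`. Write `u ≤ v` for the likelihood ratio
order of two measures on the line `x = m`, that is, `u k * v l ≤ u l * v k` for `l < k`. Then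
log-concavity of `p` says that the exit distribution of `Γ` from `(0, 0)` is `≤` that of
`Γ + (0, 1)` from `(0, 1)`. With `U` the union of the two regions, this follows by transitivity
(`likelihood_ratio_trans`) from three comparisons: of `Γ` with `U` from `(0, 0)`; of `(0, 0)` with
`(0, 1)` in `U`; and of `U` with `Γ + (0, 1)` from `(0, 1)`. The last one is a reflection of the
first (`Band.hit_mul_hit_le_edgeUnion`, `Band.hit_mul_hit_le_sq`).

All of them come from one inequality for a walk on an arbitrary finite directed subgraph of the
strip (`hit_mul_hit_le_of_isAbove`): the exit distribution from `(0, i)` is `≤` the one from `w`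
if `w` lies above. By the maximum principle (`exists_neg_walk`), a violation would produce a path
from `w` to `(m, l)` on which a suitable combination of the harmonic functions "probability of exit
at `(m, k)`" and "probability of exit at `(m, l)`" is negative, while this combination vanishes at
`(0, i)`. But that path cannot be avoided on the way from `(0, i)` to `(m, k)`
(`not_reachable_off`), so the combination would have to be negative at `(0, i)`, too. The planarity
used here is a parity count of the horizontal steps of the path below a moving point
(`exists_parity`).

To pass from `U` to `Γ`, directed edges `P → Q` at the upper boundary are removed one at a time.
Removing one of them subtracts from the exit distribution a multiple of the exit distribution from
`Q`, to which the inequality for `w = Q` applies (`hit_mul_hit_le_of_remove_edge`). Arbitrary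
directed graphs are allowed so that all the intermediate graphs are covered.
-/

namespace StripWalk

/-! ### Walks on directed subgraphs of a strip -/

/-- The four unit vectors of `ℤ²`. -/
def unitSteps : Finset (ℤ × ℤ) := {(1, 0), (-1, 0), (0, 1), (0, -1)}

lemma mem_unitSteps_of_nearestNeighbor {P Q : ℤ × ℤ} (h : NearestNeighbor P Q) :
    Q - P ∈ unitSteps := by
  obtain ⟨a, b⟩ := P
  obtain ⟨c, d⟩ := Q
  simp only [NearestNeighbor] at h
  simp only [unitSteps, Finset.mem_insert, Finset.mem_singleton, Prod.mk_sub_mk, Prod.mk.injEq]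
  rcases abs_cases (a - c) with h1 | h1 <;> rcases abs_cases (b - d) with h2 | h2 <;> omega

lemma nearestNeighbor_of_mem_unitSteps {e : ℤ × ℤ} (he : e ∈ unitSteps) :
    NearestNeighbor (0, 0) e := by
  simp only [unitSteps, Finset.mem_insert, Finset.mem_singleton] at he
  rcases he with rfl | rfl | rfl | rfl <;> simp [NearestNeighbor]

/-- A directed graph on `ℤ²`, given by its edge relation, whose edges are unit steps inside a
bounded part of the strip `0 ≤ x ≤ m` and none of which leaves the line `x = m`. The walk on the
graph is thereby stopped on that line. -/
structure IsStripGraph (m : ℕ) (R : ℤ × ℤ → ℤ × ℤ → Prop) : Prop where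
  nearest : ∀ {P Q}, R P Q → NearestNeighbor P Q
  source_nonneg : ∀ {P Q}, R P Q → 0 ≤ P.1
  source_lt : ∀ {P Q}, R P Q → P.1 < m
  target_nonneg : ∀ {P Q}, R P Q → 0 ≤ Q.1
  target_le : ∀ {P Q}, R P Q → Q.1 ≤ m
  bounded : ∃ B : ℤ, ∀ {P Q}, R P Q → |Q.2| ≤ B

lemma IsStripGraph.mono {m : ℕ} {R R' : ℤ × ℤ → ℤ × ℤ → Prop} (h : IsStripGraph m R')
    (hle : ∀ P Q, R P Q → R' P Q) : IsStripGraph m R := by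
  obtain ⟨B, hB⟩ := h.bounded
  exact ⟨fun e => h.nearest (hle _ _ e), fun e => h.source_nonneg (hle _ _ e),
    fun e => h.source_lt (hle _ _ e), fun e => h.target_nonneg (hle _ _ e),
    fun e => h.target_le (hle _ _ e), B, fun e => hB (hle _ _ e)⟩

lemma IsStripGraph.exists_eq_add {m : ℕ} {R : ℤ × ℤ → ℤ × ℤ → Prop} (h : IsStripGraph m R)
    {P Q : ℤ × ℤ} (e : R P Q) : ∃ d ∈ unitSteps, Q = P + d :=
  ⟨Q - P, mem_unitSteps_of_nearestNeighbor (h.nearest e), by simp⟩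

open Classical in
/-- One step of the walk that chooses each unit vector with probability `1/4` and is killed if the
chosen step is not an edge of `R`: the expectation of `f` after a step from `z`. -/
noncomputable def avg (R : ℤ × ℤ → ℤ × ℤ → Prop) (f : ℤ × ℤ → ℝ) (z : ℤ × ℤ) : ℝ :=
  (∑ e ∈ unitSteps, if R z (z + e) then f (z + e) else 0) / 4

lemma card_unitSteps : unitSteps.card = 4 := by decide

lemma avg_const_mul (R : ℤ × ℤ → ℤ × ℤ → Prop) (c : ℝ) (f : ℤ × ℤ → ℝ) (z : ℤ × ℤ) :
    avg R (fun v => c * f v) z = c * avg R f z := by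
  classical
  simp only [avg, mul_div_assoc', Finset.mul_sum, mul_ite, mul_zero]

lemma avg_sub (R : ℤ × ℤ → ℤ × ℤ → Prop) (f g : ℤ × ℤ → ℝ) (z : ℤ × ℤ) :
    avg R (fun v => f v - g v) z = avg R f z - avg R g z := by
  classical
  simp only [avg, ← sub_div, ← Finset.sum_sub_distrib]
  congr 1
  refine Finset.sum_congr rfl fun e _ => ?_
  split_ifs <;> simp

lemma avg_neg (R : ℤ × ℤ → ℤ × ℤ → Prop) (f : ℤ × ℤ → ℝ) (z : ℤ × ℤ) :
    avg R (fun v => - f v) z = - avg R f z := by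
  simpa using avg_const_mul R (-1) f z

lemma avg_le_avg {R R' : ℤ × ℤ → ℤ × ℤ → Prop} (hle : ∀ P Q, R P Q → R' P Q)
    {f g : ℤ × ℤ → ℝ} (hfg : ∀ v, f v ≤ g v) (hg : ∀ v, 0 ≤ g v) (z : ℤ × ℤ) :
    avg R f z ≤ avg R' g z := by
  classical
  simp only [avg]
  gcongr with e
  split_ifs with h1 h2 h2
  · exact hfg _
  · exact absurd (hle _ _ h1) h2
  · exact hg _
  · exact le_rfl

lemma avg_nonneg (R : ℤ × ℤ → ℤ × ℤ → Prop) {f : ℤ × ℤ → ℝ} (hf : ∀ v, 0 ≤ f v) (z : ℤ × ℤ) :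
    0 ≤ avg R f z := by
  classical
  refine div_nonneg (Finset.sum_nonneg fun e _ => ?_) (by norm_num)
  split_ifs
  exacts [hf _, le_rfl]

/-- The probability that the walk on `R`, started from `z`, hits the line `x = m` within `n` steps
and does so first at `(m, k)`. -/
noncomputable def hitWithin (m : ℕ) (R : ℤ × ℤ → ℤ × ℤ → Prop) (k : ℤ) : ℕ → ℤ × ℤ → ℝ
  | 0, z => if z = ((m : ℤ), k) then 1 else 0
  | n + 1, z =>
    if z.1 = m then if z = ((m : ℤ), k) then 1 else 0 else avg R (hitWithin m R k n) z

/-- The probability that the walk on `R`, started from `z`, first hits the line `x = m` at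
`(m, k)`. -/
noncomputable def hit (m : ℕ) (R : ℤ × ℤ → ℤ × ℤ → Prop) (k : ℤ) (z : ℤ × ℤ) : ℝ :=
  ⨆ n, hitWithin m R k n z

section Hit

variable {m : ℕ} {R R' : ℤ × ℤ → ℤ × ℤ → Prop} {k : ℤ}

lemma hitWithin_nonneg (n : ℕ) (z : ℤ × ℤ) : 0 ≤ hitWithin m R k n z := by
  induction n generalizing z with
  | zero => rw [hitWithin]; split_ifs <;> norm_num
  | succ n ih =>
    rw [hitWithin]
    split_ifs
    exacts [zero_le_one, le_rfl, avg_nonneg R ih z]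

lemma hitWithin_le_one (n : ℕ) (z : ℤ × ℤ) : hitWithin m R k n z ≤ 1 := by
  classical
  induction n generalizing z with
  | zero => rw [hitWithin]; split_ifs <;> norm_num
  | succ n ih =>
    rw [hitWithin]
    split_ifs
    · exact le_rfl
    · exact zero_le_one
    · rw [avg, div_le_one (by norm_num)]
      calc _ ≤ ∑ e ∈ unitSteps, (1 : ℝ) := Finset.sum_le_sum fun e _ => by
              split_ifs
              exacts [ih _, zero_le_one]
        _ = 4 := by simp [card_unitSteps]

lemma hitWithin_mono (hle : ∀ P Q, R P Q → R' P Q) (n : ℕ) (z : ℤ × ℤ) :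
    hitWithin m R k n z ≤ hitWithin m R' k n z := by
  induction n generalizing z with
  | zero => exact le_rfl
  | succ n ih =>
    simp only [hitWithin]
    split_ifs
    exacts [le_rfl, le_rfl, avg_le_avg hle ih (hitWithin_nonneg n) z]

lemma hitWithin_le_succ (n : ℕ) (z : ℤ × ℤ) :
    hitWithin m R k n z ≤ hitWithin m R k (n + 1) z := by
  induction n generalizing z with
  | zero =>
    by_cases h : z.1 = m
    · simp [hitWithin, h]
    · have h' : z ≠ ((m : ℤ), k) := fun e => h (by rw [e])
      rw [hitWithin, if_neg h']
      exact hitWithin_nonneg 1 z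
  | succ n ih =>
    rw [hitWithin.eq_2, hitWithin.eq_2]
    split_ifs
    exacts [le_rfl, le_rfl, avg_le_avg (fun _ _ => id) ih (hitWithin_nonneg _) z]

lemma tendsto_hitWithin (z : ℤ × ℤ) :
    Filter.Tendsto (fun n => hitWithin m R k n z) Filter.atTop (nhds (hit m R k z)) :=
  tendsto_atTop_ciSup (monotone_nat_of_le_succ fun n => hitWithin_le_succ n z)
    ⟨1, by rintro _ ⟨n, rfl⟩; exact hitWithin_le_one n z⟩

lemma hit_nonneg (z : ℤ × ℤ) : 0 ≤ hit m R k z :=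
  Real.iSup_nonneg fun n => hitWithin_nonneg n z

lemma hit_mono (hle : ∀ P Q, R P Q → R' P Q) (z : ℤ × ℤ) : hit m R k z ≤ hit m R' k z :=
  le_of_tendsto_of_tendsto' (tendsto_hitWithin z) (tendsto_hitWithin z)
    fun n => hitWithin_mono hle n z

lemma hit_of_fst_eq {z : ℤ × ℤ} (hz : z.1 = m) :
    hit m R k z = if z = ((m : ℤ), k) then 1 else 0 := by
  refine tendsto_nhds_unique (tendsto_hitWithin z) (tendsto_const_nhds.congr fun n => ?_)
  cases n <;> simp [hitWithin, hz]

/-- The hitting probability is harmonic off the line `x = m`. -/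
lemma hit_eq_avg {z : ℤ × ℤ} (hz : z.1 ≠ m) : hit m R k z = avg R (hit m R k) z := by
  classical
  have h1 := (Filter.tendsto_add_atTop_iff_nat 1).2 (tendsto_hitWithin (m := m) (R := R) (k := k) z)
  refine tendsto_nhds_unique h1 ?_
  simp only [hitWithin, if_neg hz]
  refine Filter.Tendsto.div_const (tendsto_finsetSum _ fun e _ => ?_) _
  split_ifs
  exacts [tendsto_hitWithin _, tendsto_const_nhds]

lemma reachable_of_hit_pos {z : ℤ × ℤ} (h : 0 < hit m R k z) :
    Relation.ReflTransGen R z ((m : ℤ), k) := by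
  classical
  by_contra hn
  have key : ∀ n z, ¬ Relation.ReflTransGen R z ((m : ℤ), k) → hitWithin m R k n z = 0 := by
    intro n
    induction n with
    | zero =>
      intro z hz
      rw [hitWithin, if_neg]
      rintro rfl
      exact hz .refl
    | succ n ih =>
      intro z hz
      have hne : z ≠ ((m : ℤ), k) := by
        rintro rfl
        exact hz .refl
      rw [hitWithin, if_neg hne]
      split_ifs
      · rfl
      · rw [avg, Finset.sum_eq_zero, zero_div]
        intro e _
        split_ifs with hR
        · exact ih _ fun h' => hz (.head hR h')
        · rfl
  have : hit m R k z = 0 := by simp [hit, key _ z hn]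
  exact h.ne' this

end Hit

/-! ### The maximum principle -/

section MaximumPrinciple

variable {m : ℕ} {R : ℤ × ℤ → ℤ × ℤ → Prop} {f : ℤ × ℤ → ℝ}

/-- Maximum principle: if a function that is harmonic off the line `x = m` is negative at `w`, then
it is negative along some walk from `w` to that line. -/
lemma exists_neg_walk (hR : IsStripGraph m R) (hf : ∀ z : ℤ × ℤ, z.1 ≠ m → f z = avg R f z)
    {w : ℤ × ℤ} (hw : f w < 0) :
    ∃ v : ℤ × ℤ, v.1 = m ∧ f v < 0 ∧ Relation.ReflTransGen (fun P Q => R P Q ∧ f Q < 0) w v := by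
  classical
  by_contra! hcon
  set C : Set (ℤ × ℤ) := {v | Relation.ReflTransGen (fun P Q => R P Q ∧ f Q < 0) w v} with hC
  have hneg : ∀ v ∈ C, f v < 0 := by
    intro v hv
    rcases Relation.ReflTransGen.cases_tail hv with h | ⟨u, -, -, h⟩
    · rwa [h]
    · exact h
  have hfin : C.Finite := by
    obtain ⟨B, hB⟩ := hR.bounded
    refine ((Set.finite_Icc ((0 : ℤ), -B) ((m : ℤ), B)).insert w).subset fun v hv => ?_
    rcases Relation.ReflTransGen.cases_tail hv with h | ⟨u, -, h, -⟩
    · exact Or.inl h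
    · have h1 := abs_le.1 (hB h)
      exact Or.inr ⟨⟨hR.target_nonneg h, h1.1⟩, ⟨hR.target_le h, h1.2⟩⟩
  -- Among the minimizers of `f`, take a highest one: its upper neighbour is no minimizer.
  obtain ⟨z, hz, hmin⟩ := Set.exists_min_image C (fun v => toLex (f v, -v.2)) hfin ⟨w, .refl⟩
  have hmin' : ∀ v ∈ C, f z < f v ∨ f z = f v ∧ v.2 ≤ z.2 := by
    intro v hv
    have := hmin v hv
    rw [Prod.Lex.toLex_le_toLex] at this
    simpa using this
  have hzm : z.1 ≠ m := fun h => hcon z h (hneg z hz) hz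
  have hterm : ∀ e ∈ unitSteps, f z ≤ if R z (z + e) then f (z + e) else 0 := by
    intro e _
    split_ifs with he
    · by_cases h0 : f (z + e) < 0
      · rcases hmin' (z + e) (Relation.ReflTransGen.tail hz ⟨he, h0⟩) with h | h
        exacts [h.le, h.1.le]
      · exact (hneg z hz).le.trans (not_lt.1 h0)
    · exact (hneg z hz).le
  have hup : ((0 : ℤ), (1 : ℤ)) ∈ unitSteps := by decide
  have hlt : f z < if R z (z + (0, 1)) then f (z + (0, 1)) else 0 := by
    split_ifs with he
    · by_cases h0 : f (z + (0, 1)) < 0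
      · rcases hmin' _ (Relation.ReflTransGen.tail hz ⟨he, h0⟩) with h | h
        · exact h
        · have := h.2
          simp at this
      · exact (hneg z hz).trans_le (not_lt.1 h0)
    · exact hneg z hz
  have hsum := Finset.sum_lt_sum hterm ⟨_, hup, hlt⟩
  have heq := hf z hzm
  rw [avg] at heq
  rw [Finset.sum_const, card_unitSteps, nsmul_eq_mul] at hsum
  push_cast at hsum
  linarith

lemma exists_pos_walk (hR : IsStripGraph m R) (hf : ∀ z : ℤ × ℤ, z.1 ≠ m → f z = avg R f z)
    {w : ℤ × ℤ} (hw : 0 < f w) :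
    ∃ v : ℤ × ℤ, v.1 = m ∧ 0 < f v ∧ Relation.ReflTransGen (fun P Q => R P Q ∧ 0 < f Q) w v := by
  have := exists_neg_walk (f := fun v => - f v) hR
    (fun z hz => by rw [avg_neg, ← hf z hz]) (w := w) (by simpa using hw)
  simpa using this

/-- A harmonic function that vanishes on the line `x = m` vanishes identically. -/
lemma eq_zero_of_harmonic (hR : IsStripGraph m R) (hf : ∀ z : ℤ × ℤ, z.1 ≠ m → f z = avg R f z)
    (h0 : ∀ z : ℤ × ℤ, z.1 = m → f z = 0) (z : ℤ × ℤ) : f z = 0 := by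
  rcases lt_trichotomy (f z) 0 with h | h | h
  · obtain ⟨v, hv, hv', -⟩ := exists_neg_walk hR hf h
    exact absurd (h0 v hv) hv'.ne
  · exact h
  · obtain ⟨v, hv, hv', -⟩ := exists_pos_walk hR hf h
    exact absurd (h0 v hv) hv'.ne'

end MaximumPrinciple

/-! ### Crossing of planar walks -/

section Crossing

variable {m : ℕ} {R : ℤ × ℤ → ℤ × ℤ → Prop}

/-- Indicator (mod 2) of the vertical half-line from `(x, y)` downwards. -/
def below (x y : ℤ) (P : ℤ × ℤ) : ZMod 2 := if P.1 = x ∧ P.2 ≤ y then 1 else 0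

/-- Indicator (mod 2) of the event that the unit step from `P` to `Q` is horizontal, between the
lines `x` and `x + 1`, and not higher than `y`. -/
def crosses (P Q : ℤ × ℤ) (x y : ℤ) : ZMod 2 :=
  if P.2 = Q.2 ∧ min P.1 Q.1 = x ∧ P.2 ≤ y then 1 else 0

lemma crosses_add_crosses {P Q : ℤ × ℤ} (h : NearestNeighbor P Q) {x y : ℤ}
    (hP : P ≠ (x, y)) (hQ : Q ≠ (x, y)) :
    crosses P Q (x - 1) y + crosses P Q x y = below x y P + below x y Q := by
  have h11 : (1 : ZMod 2) + 1 = 0 := by decide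
  obtain ⟨a, b⟩ := P
  obtain ⟨d, hd⟩ : ∃ d ∈ unitSteps, Q = (a, b) + d :=
    ⟨_, mem_unitSteps_of_nearestNeighbor h, by simp⟩
  simp only [ne_eq, Prod.mk.injEq, not_and_or] at hP
  obtain ⟨hd, rfl⟩ := hd
  simp only [unitSteps, Finset.mem_insert, Finset.mem_singleton] at hd
  rcases hd with rfl | rfl | rfl | rfl <;>
    simp only [Prod.mk_add_mk, ne_eq, Prod.mk.injEq, not_and_or] at hQ <;>
    simp only [crosses, below, Prod.mk_add_mk] <;> split_ifs <;>
    first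
      | (exfalso; omega)
      | simp only [h11, add_zero, zero_add]

lemma crosses_add_one {P Q : ℤ × ℤ} {x y : ℤ} (h : NearestNeighbor P Q)
    (hPQ : (P ≠ (x, y + 1) ∧ Q ≠ (x, y + 1)) ∨ (P ≠ (x + 1, y + 1) ∧ Q ≠ (x + 1, y + 1))) :
    crosses P Q x (y + 1) = crosses P Q x y := by
  obtain ⟨a, b⟩ := P
  obtain ⟨d, hd⟩ : ∃ d ∈ unitSteps, Q = (a, b) + d :=
    ⟨_, mem_unitSteps_of_nearestNeighbor h, by simp⟩
  obtain ⟨hd, rfl⟩ := hd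
  simp only [unitSteps, Finset.mem_insert, Finset.mem_singleton] at hd
  rcases hd with rfl | rfl | rfl | rfl <;>
    simp only [Prod.mk_add_mk, ne_eq, Prod.mk.injEq, not_and_or] at hPQ <;>
    simp only [crosses, Prod.mk_add_mk] <;> split_ifs <;>
    first
      | rfl
      | (exfalso; omega)

/-- For a walk from `w` to `v` inside a set `F`, let `N x y` be the number (mod 2) of its steps
that pass below the segment from `(x, y)` to `(x + 1, y)`, or along it. Off `F`, this number
changes only where the vertical half-line below a point contains an end of the walk. -/
lemma exists_parity (hR : IsStripGraph m R) {F : ℤ × ℤ → Prop} {w v : ℤ × ℤ} (hw : F w)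
    (h : Relation.ReflTransGen (fun P Q => R P Q ∧ F Q) w v) :
    ∃ N : ℤ → ℤ → ZMod 2,
      (∀ x y, ¬ F (x, y) → N (x - 1) y + N x y = below x y w + below x y v) ∧
      (∀ x y, ¬ F (x, y + 1) ∨ ¬ F (x + 1, y + 1) → N x (y + 1) = N x y) ∧
      (∀ x y, x < 0 ∨ (m : ℤ) ≤ x → N x y = 0) := by
  induction h with
  | refl =>
    refine ⟨fun _ _ => 0, fun x y _ => ?_, fun _ _ _ => rfl, fun _ _ _ => rfl⟩
    exact (add_zero 0).trans (CharTwo.add_self_eq_zero _).symm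
  | @tail P Q hwP hPQ ih =>
    obtain ⟨N, h1, h2, h3⟩ := ih
    have hP : F P := by
      rcases Relation.ReflTransGen.cases_tail hwP with h | ⟨u, -, -, h⟩
      · rwa [h]
      · exact h
    have hne : ∀ z, ¬ F z → P ≠ z ∧ Q ≠ z := fun z hz =>
      ⟨fun e => hz (e ▸ hP), fun e => hz (e ▸ hPQ.2)⟩
    have hnn := hR.nearest hPQ.1
    refine ⟨fun x y => N x y + crosses P Q x y, fun x y hxy => ?_, fun x y hxy => ?_,
      fun x y hx => ?_⟩
    · have e := crosses_add_crosses hnn (hne _ hxy).1 (hne _ hxy).2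
      have e1 := h1 x y hxy
      have e2 : below x y P + below x y P = 0 := CharTwo.add_self_eq_zero _
      linear_combination e + e1 + e2
    · simp only
      rw [h2 x y hxy, crosses_add_one hnn (hxy.imp (hne _) (hne _))]
    · simp only
      rw [h3 x y hx, zero_add, crosses, if_neg]
      have a1 := hR.source_nonneg hPQ.1
      have a2 := hR.source_lt hPQ.1
      have a3 := hR.target_nonneg hPQ.1
      have a4 := hR.target_le hPQ.1
      omega

/-- A condition under which a walk from `w` to the line `x = m` leaves on its lower side every walk
from `(0, i)` that it does not meet: all horizontal edges in the strip to the right of `w`, or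
all those in the strip to the left of `w`, are at most as high as `w`. In the latter case, `w` must
not be on the line `x = 0` at or below `(0, i)`. -/
def IsAbove (m : ℕ) (R : ℤ × ℤ → ℤ × ℤ → Prop) (i : ℤ) (w : ℤ × ℤ) : Prop :=
  (w.1 < m ∧ ∀ y, R (w.1, y) (w.1 + 1, y) ∨ R (w.1 + 1, y) (w.1, y) → y ≤ w.2) ∨
  ((w.1 ≠ 0 ∨ i < w.2) ∧ ∀ y, R (w.1 - 1, y) (w.1, y) ∨ R (w.1, y) (w.1 - 1, y) → y ≤ w.2)

lemma IsAbove.anti {R' : ℤ × ℤ → ℤ × ℤ → Prop} {i : ℤ} {w : ℤ × ℤ} (h : IsAbove m R' i w)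
    (hle : ∀ P Q, R P Q → R' P Q) : IsAbove m R i w :=
  h.imp (fun h => ⟨h.1, fun y hy => h.2 y (hy.imp (hle _ _) (hle _ _))⟩)
    (fun h => ⟨h.1, fun y hy => h.2 y (hy.imp (hle _ _) (hle _ _))⟩)

/-- Edges of a strip graph, by direction. -/
lemma IsStripGraph.exists_direction (hR : IsStripGraph m R) {P Q : ℤ × ℤ} (e : R P Q) :
    ∃ x y, (P = (x, y) ∧ Q = (x + 1, y)) ∨ (P = (x + 1, y) ∧ Q = (x, y)) ∨
      (P = (x, y) ∧ Q = (x, y + 1)) ∨ (P = (x, y + 1) ∧ Q = (x, y)) := by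
  obtain ⟨d, hd, rfl⟩ := hR.exists_eq_add e
  obtain ⟨a, b⟩ := P
  simp only [unitSteps, Finset.mem_insert, Finset.mem_singleton] at hd
  rcases hd with rfl | rfl | rfl | rfl
  · exact ⟨a, b, by simp⟩
  · exact ⟨a - 1, b, by simp [sub_eq_add_neg]⟩
  · exact ⟨a, b, by simp⟩
  · exact ⟨a, b - 1, by simp [sub_eq_add_neg]⟩

/-- Planarity: a walk in `F` from `w` to `(m, l)` and a walk off `F` from `(0, i)` to `(m, k)`
cannot coexist when `l < k` and `w` is above the walks from `(0, i)`. -/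
lemma not_reachable_off (hm : 0 < m) (hR : IsStripGraph m R) {F : ℤ × ℤ → Prop} {i k l : ℤ}
    (hlk : l < k) {w : ℤ × ℤ} (hw : F w) (hab : IsAbove m R i w)
    (hwl : Relation.ReflTransGen (fun P Q => R P Q ∧ F Q) w ((m : ℤ), l))
    (hi : ¬ F (0, i)) :
    ¬ Relation.ReflTransGen (fun P Q => R P Q ∧ ¬ F Q) (0, i) ((m : ℤ), k) := by
  intro hik
  obtain ⟨N, h1, h2, h3⟩ := exists_parity hR hw hwl
  have hm' : (0 : ℤ) < m := by exact_mod_cast hm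
  have hoff : ∀ z, Relation.ReflTransGen (fun P Q => R P Q ∧ ¬ F Q) (0, i) z → ¬ F z := by
    intro z hz
    rcases Relation.ReflTransGen.cases_tail hz with h | ⟨u, -, -, h⟩
    · rwa [h]
    · exact h
  have hk := hoff _ hik
  have hl0 : ∀ x y, x < (m : ℤ) → below x y ((m : ℤ), l) = 0 := by
    intro x y hx
    exact if_neg fun h => hx.ne' h.1
  have hl1 : below (m : ℤ) k ((m : ℤ), l) = 1 := if_pos ⟨rfl, hlk.le⟩
  have hend := h1 m k hk
  rw [hl1, h3 m k (.inr le_rfl), add_zero] at hend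
  rcases hab with ⟨hwm, hab⟩ | ⟨hw0, hab⟩
  · -- The walk from `(0, i)` sees an even number of steps below it in the strip to its left.
    have key : ∀ z, Relation.ReflTransGen (fun P Q => R P Q ∧ ¬ F Q) (0, i) z →
        N (z.1 - 1) z.2 = 0 := by
      intro z hz
      induction hz with
      | refl => exact h3 _ _ (.inl (by simp))
      | @tail P Q hP hPQ ih =>
        have hFP := hoff P hP
        have hFQ := hPQ.2
        have hsrc := hR.source_lt hPQ.1
        have hb : ∀ x y, ¬ F (x, y) → R (x, y) (x + 1, y) ∨ R (x + 1, y) (x, y) →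
            below x y w = 0 := by
          intro x y hxy hRxy
          refine if_neg ?_
          rintro ⟨rfl, hle⟩
          have : y = w.2 := le_antisymm (hab y hRxy) hle
          exact hxy (by rw [this]; exact hw)
        obtain ⟨x, y, ⟨rfl, rfl⟩ | ⟨rfl, rfl⟩ | ⟨rfl, rfl⟩ | ⟨rfl, rfl⟩⟩ :=
          hR.exists_direction hPQ.1
        · have e := h1 x y hFP
          rw [hb x y hFP (.inl hPQ.1), hl0 x y hsrc] at e
          simp only [add_sub_cancel_right] at ih ⊢
          linear_combination e - ih
        · have e := h1 x y hFQ
          simp only at hsrc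
          rw [hb x y hFQ (.inr hPQ.1), hl0 x y (by omega)] at e
          simp only [add_sub_cancel_right] at ih ⊢
          linear_combination e - ih
        · simp only at ih ⊢
          rw [h2 (x - 1) y (.inr (by simpa using hFQ)), ih]
        · simp only at ih ⊢
          rw [← h2 (x - 1) y (.inr (by simpa using hFP)), ih]
    rw [key _ hik, below, if_neg (by omega)] at hend
    exact absurd hend (by decide)
  · -- The walk from `(0, i)` sees an even number of steps below it in the strip to its right.
    have hb : ∀ x y, ¬ F (x, y) → R (x - 1, y) (x, y) ∨ R (x, y) (x - 1, y) →
        below x y w = 0 := by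
      intro x y hxy hRxy
      refine if_neg ?_
      rintro ⟨rfl, hle⟩
      have : y = w.2 := le_antisymm (hab y hRxy) hle
      exact hxy (by rw [this]; exact hw)
    have key : ∀ z, Relation.ReflTransGen (fun P Q => R P Q ∧ ¬ F Q) (0, i) z →
        (z.1 < m → N z.1 z.2 = 0) ∧ z ≠ ((m : ℤ), k) := by
      intro z hz
      induction hz with
      | refl =>
        refine ⟨fun _ => ?_, fun h => ?_⟩
        · have e := h1 0 i hi
          rw [h3 (0 - 1) i (.inl (by simp)), hl0 0 i hm', below, if_neg (by omega)] at e
          simpa using e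
        · have := congrArg Prod.fst h
          simp only at this
          omega
      | @tail P Q hP hPQ ih =>
        have hFP := hoff P hP
        have hFQ := hPQ.2
        have hsrc := hR.source_lt hPQ.1
        replace ih := ih.1 hsrc
        obtain ⟨x, y, ⟨rfl, rfl⟩ | ⟨rfl, rfl⟩ | ⟨rfl, rfl⟩ | ⟨rfl, rfl⟩⟩ :=
          hR.exists_direction hPQ.1
        · simp only at ih ⊢
          have hbw := hb (x + 1) y hFQ (.inl (by simpa using hPQ.1))
          have e := h1 (x + 1) y hFQ
          rw [hbw, add_sub_cancel_right, ih, zero_add, zero_add] at e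
          refine ⟨fun hx => by rw [e, hl0 _ _ hx], fun h => ?_⟩
          obtain ⟨hx, rfl⟩ := Prod.mk.inj h
          rw [hx, hl1, h3 m y (.inr le_rfl)] at e
          exact absurd e (by decide)
        · simp only at ih hsrc ⊢
          have hbw := hb (x + 1) y hFP (.inr (by simpa using hPQ.1))
          have e := h1 (x + 1) y hFP
          rw [hbw, add_sub_cancel_right, ih, hl0 _ _ hsrc, add_zero, zero_add] at e
          refine ⟨fun _ => e, fun h => ?_⟩
          have := congrArg Prod.fst h
          simp only at this
          omega
        · simp only at ih hsrc ⊢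
          refine ⟨fun _ => by rw [h2 x y (.inl hFQ), ih], fun h => ?_⟩
          have := congrArg Prod.fst h
          simp only at this
          omega
        · simp only at ih hsrc ⊢
          refine ⟨fun _ => by rw [← h2 x y (.inl hFP), ih], fun h => ?_⟩
          have := congrArg Prod.fst h
          simp only at this
          omega
    exact (key _ hik).2 rfl

end Crossing

/-! ### Likelihood ratio comparisons of hitting distributions -/

section Comparison

variable {m : ℕ} {R R' : ℤ × ℤ → ℤ × ℤ → Prop}

/-- The hitting distribution from `w` dominates the one from `(0, i)` in the likelihood ratio order
if `w` is above `(0, i)`. Otherwise, the harmonic function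
`f = hit l (0, i) * hit k - hit k (0, i) * hit l` would be negative along a walk from `w` to
`(m, l)`, which separates `(0, i)` from the only point `(m, k)` of the line `x = m` where `f` can be
positive. This contradicts `f (0, i) = 0`. -/
lemma hit_mul_hit_le_of_isAbove (hm : 0 < m) (hR : IsStripGraph m R) {i k l : ℤ} (hlk : l < k)
    {w : ℤ × ℤ} (hab : IsAbove m R i w) :
    hit m R k (0, i) * hit m R l w ≤ hit m R l (0, i) * hit m R k w := by
  classical
  by_contra! hlt
  set f : ℤ × ℤ → ℝ := fun v => hit m R l (0, i) * hit m R k v - hit m R k (0, i) * hit m R l v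
    with hf
  have hharm : ∀ z : ℤ × ℤ, z.1 ≠ m → f z = avg R f z := by
    intro z hz
    rw [hf, avg_sub, avg_const_mul, avg_const_mul, ← hit_eq_avg hz, ← hit_eq_avg hz]
  have hfw : f w < 0 := sub_neg.2 hlt
  have hfi : f (0, i) = 0 := by simp only [hf]; ring
  have hkl : ((m : ℤ), k) ≠ ((m : ℤ), l) := by simp [hlk.ne']
  have hfneg : ∀ v : ℤ × ℤ, v.1 = m → f v < 0 → v = ((m : ℤ), l) := by
    intro v hv hv0
    by_contra hne
    simp only [hf] at hv0
    rw [hit_of_fst_eq (k := l) hv, if_neg hne] at hv0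
    have := mul_nonneg (hit_nonneg (m := m) (R := R) (k := l) (0, i))
      (hit_nonneg (m := m) (R := R) (k := k) v)
    linarith
  have hfpos : ∀ v : ℤ × ℤ, v.1 = m → 0 < f v → v = ((m : ℤ), k) := by
    intro v hv hv0
    by_contra hne
    simp only [hf] at hv0
    rw [hit_of_fst_eq (k := k) hv, if_neg hne] at hv0
    have := mul_nonneg (hit_nonneg (m := m) (R := R) (k := k) (0, i))
      (hit_nonneg (m := m) (R := R) (k := l) v)
    linarith
  obtain ⟨v, hv, hv0, hwv⟩ := exists_neg_walk hR hharm hfw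
  obtain rfl := hfneg v hv hv0
  have hoff := not_reachable_off hm hR (F := fun z => f z < 0) hlk hfw hab hwv (by simp [hfi])
  have hnonpos : ∀ z, Relation.ReflTransGen (fun P Q => R P Q ∧ ¬ f Q < 0) (0, i) z → f z ≤ 0 := by
    intro z hz
    by_contra! hz0
    obtain ⟨v, hv, hv0, hzv⟩ := exists_pos_walk hR hharm hz0
    obtain rfl := hfpos v hv hv0
    exact hoff (hz.trans (Relation.ReflTransGen.mono (fun P Q h => ⟨h.1, h.2.le.not_gt⟩) _ _ hzv))
  -- As `f (0, i) = 0` is the average of nonpositive values, `f` vanishes on all walks from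
  -- `(0, i)`.
  have hreach : ∀ z, Relation.ReflTransGen R (0, i) z →
      f z = 0 ∧ Relation.ReflTransGen (fun P Q => R P Q ∧ ¬ f Q < 0) (0, i) z := by
    intro z hz
    induction hz with
    | refl => exact ⟨hfi, .refl⟩
    | @tail P Q _ hPQ ih =>
      have hle : ∀ e ∈ unitSteps, (if R P (P + e) then f (P + e) else 0) ≤ 0 := by
        intro e _
        split_ifs with he
        · by_contra! h0
          exact h0.not_ge (hnonpos _ (ih.2.tail ⟨he, h0.le.not_gt⟩))
        · exact le_rfl
      have hsum : ∑ e ∈ unitSteps, (if R P (P + e) then f (P + e) else 0) = 0 := by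
        have h := hharm P (hR.source_lt hPQ).ne
        rw [ih.1, avg] at h
        linarith
      obtain ⟨e, he, rfl⟩ := hR.exists_eq_add hPQ
      have h0 := (Finset.sum_eq_zero_iff_of_nonpos hle).1 hsum e he
      rw [if_pos hPQ] at h0
      exact ⟨h0, ih.2.tail ⟨hPQ, by simp [h0]⟩⟩
  have hpos : 0 < hit m R k (0, i) := by
    refine (hit_nonneg _).lt_of_ne fun h0 => ?_
    have := mul_nonneg (hit_nonneg (m := m) (R := R) (k := l) (0, i))
      (hit_nonneg (m := m) (R := R) (k := k) w)
    rw [← h0, zero_mul] at hlt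
    linarith
  exact hoff (hreach _ (reachable_of_hit_pos hpos)).2

/-- Transitivity of the likelihood ratio order at a pair of points, for distributions
`u`, `v`, `w`; the hypothesis `h` takes care of points that `v` does not charge. -/
lemma likelihood_ratio_trans {uk ul vk vl wk wl : ℝ} (huk : 0 ≤ uk) (hul : 0 ≤ ul) (hvl : 0 ≤ vl)
    (hwk : 0 ≤ wk) (hwl : 0 ≤ wl) (h : uk ≤ vk ∨ wl ≤ vl)
    (h1 : uk * vl ≤ ul * vk) (h2 : vk * wl ≤ vl * wk) :
    uk * wl ≤ ul * wk := by
  by_cases h0 : uk * wl = 0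
  · rw [h0]
    positivity
  have huk' : 0 < uk := huk.lt_of_ne' (left_ne_zero_of_mul h0)
  have hwl' : 0 < wl := hwl.lt_of_ne' (right_ne_zero_of_mul h0)
  have hv : 0 < vk ∧ 0 < vl := by
    rcases h with h | h
    · have hvk' := huk'.trans_le h
      exact ⟨hvk', pos_of_mul_pos_left ((mul_pos hvk' hwl').trans_le h2) hwk⟩
    · have hvl' := hwl'.trans_le h
      exact ⟨pos_of_mul_pos_right ((mul_pos huk' hvl').trans_le h1) hul, hvl'⟩
  have h3 : (uk * vl) * (vk * wl) ≤ (ul * vk) * (vl * wk) := by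
    calc (uk * vl) * (vk * wl) ≤ (uk * vl) * (vl * wk) := by gcongr
      _ ≤ (ul * vk) * (vl * wk) := by gcongr
  have h4 : (uk * wl) * (vk * vl) ≤ (ul * wk) * (vk * vl) := by linarith
  exact le_of_mul_le_mul_right h4 (mul_pos hv.1 hv.2)

/-- Removing from `R` an edge whose target `Q` is above `(0, i)` lowers the hitting distribution
from `(0, i)` in the likelihood ratio order: the difference of the two distributions is a
nonnegative multiple of the hitting distribution from `Q`. -/
lemma hit_mul_hit_le_of_remove_edge (hm : 0 < m) (hR : IsStripGraph m R) {i k l : ℤ} (hlk : l < k)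
    {P Q : ℤ × ℤ} (hab : IsAbove m R i Q)
    (hR' : ∀ A B, R' A B ↔ R A B ∧ (A, B) ≠ (P, Q)) :
    hit m R' k (0, i) * hit m R l (0, i) ≤ hit m R' l (0, i) * hit m R k (0, i) := by
  classical
  have hle : ∀ A B, R' A B → R A B := fun A B h => ((hR' A B).1 h).1
  set d : ℤ → ℤ × ℤ → ℝ := fun t z => hit m R t z - hit m R' t z with hd
  have hd0 : ∀ t z, 0 ≤ d t z := fun t z => sub_nonneg.2 (hit_mono hle z)
  have hdm : ∀ t, ∀ z : ℤ × ℤ, z.1 = m → d t z = 0 := by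
    intro t z hz
    simp only [hd, hit_of_fst_eq hz, sub_self]
  by_cases hPQ : R P Q
  swap
  · have : R' = R := by
      funext A B
      refine propext ((hR' A B).trans ⟨And.left, fun h => ⟨h, ?_⟩⟩)
      rintro ⟨⟩
      exact hPQ h
    rw [this, mul_comm]
  obtain ⟨e₀, he₀, hQ⟩ := hR.exists_eq_add hPQ
  -- Off the line `x = m`, `d t` is harmonic for `R'` except at `P`, where it exceeds its average by
  -- `hit m R t Q / 4`. By uniqueness, `d t` depends on `t` only through the factor `hit m R t Q`.
  have havg : ∀ t z, avg R (hit m R t) z - avg R' (hit m R t) z =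
      (if z = P then 1 / 4 else 0) * hit m R t Q := by
    intro t z
    rw [avg, avg, ← sub_div, ← Finset.sum_sub_distrib]
    by_cases hz : z = P
    · subst hz
      rw [Finset.sum_eq_single_of_mem e₀ he₀]
      · rw [← hQ, if_pos hPQ, if_neg (by simp [hR']), if_pos rfl]
        ring
      · intro e _ hne
        have : R' z (z + e) ↔ R z (z + e) := by
          rw [hR', and_iff_left]
          rw [hQ]
          simpa using hne
        simp [this]
    · rw [if_neg hz, zero_mul, Finset.sum_eq_zero, zero_div]
      intro e _
      have : R' z (z + e) ↔ R z (z + e) := by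
        rw [hR', and_iff_left]
        simp [hz]
      simp [this]
  have hdharm : ∀ t, ∀ z : ℤ × ℤ, z.1 ≠ m →
      d t z = avg R' (d t) z + (if z = P then 1 / 4 else 0) * hit m R t Q := by
    intro t z hz
    rw [← havg, hd, avg_sub]
    simp only
    rw [hit_eq_avg (R := R) hz, hit_eq_avg (R := R') hz]
    ring
  have hprop : hit m R k Q * d l (0, i) = hit m R l Q * d k (0, i) := by
    refine sub_eq_zero.1 (eq_zero_of_harmonic (hR.mono hle)
      (f := fun z => hit m R k Q * d l z - hit m R l Q * d k z) (fun z hz => ?_)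
      (fun z hz => by simp [hdm _ z hz]) (0, i))
    rw [avg_sub, avg_const_mul, avg_const_mul, hdharm l z hz, hdharm k z hz]
    ring
  have hsupp : ∀ t, hit m R t Q = 0 → d t (0, i) = 0 := by
    intro t ht
    refine eq_zero_of_harmonic (hR.mono hle) (fun z hz => ?_) (hdm t) (0, i)
    rw [hdharm t z hz, ht, mul_zero, add_zero]
  have hD := hit_mul_hit_le_of_isAbove hm hR hlk hab
  have key : d l (0, i) * hit m R k (0, i) ≤ d k (0, i) * hit m R l (0, i) := by
    rcases (hit_nonneg (m := m) (R := R) (k := k) Q).eq_or_lt with h0 | hpos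
    · have hk0 : d k (0, i) = 0 := hsupp k h0.symm
      rcases (hit_nonneg (m := m) (R := R) (k := l) Q).eq_or_lt with h1 | hpos
      · rw [hk0, hsupp l h1.symm, zero_mul, zero_mul]
      · rw [← h0, mul_zero] at hD
        have h2 := hit_nonneg (m := m) (R := R) (k := k) (0, i)
        have h3 : hit m R k (0, i) = 0 := by nlinarith
        rw [hk0, h3, mul_zero, zero_mul]
    · refine le_of_mul_le_mul_right ?_ hpos
      have := mul_le_mul_of_nonneg_left hD (hd0 k (0, i))
      calc d l (0, i) * hit m R k (0, i) * hit m R k Q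
          = (hit m R k Q * d l (0, i)) * hit m R k (0, i) := by ring
        _ = d k (0, i) * (hit m R k (0, i) * hit m R l Q) := by rw [hprop]; ring
        _ ≤ d k (0, i) * (hit m R l (0, i) * hit m R k Q) := this
        _ = d k (0, i) * hit m R l (0, i) * hit m R k Q := by ring
  simp only [hd] at key
  linarith

/-- Removing edges whose targets are above `(0, i)` lowers the hitting distribution from `(0, i)` in
the likelihood ratio order. -/
lemma hit_mul_hit_le_of_le (hm : 0 < m) (hR : IsStripGraph m R) {i k l : ℤ} (hlk : l < k)
    (hle : ∀ P Q, R' P Q → R P Q)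
    (hab : ∀ P Q, R P Q → ¬ R' P Q → IsAbove m R i Q) :
    hit m R' k (0, i) * hit m R l (0, i) ≤ hit m R' l (0, i) * hit m R k (0, i) := by
  classical
  -- The edges are removed one by one.
  have hind : ∀ E : Finset ((ℤ × ℤ) × (ℤ × ℤ)), (∀ e ∈ E, IsAbove m R i e.2) →
      hit m (fun P Q => R P Q ∧ (P, Q) ∉ E) k (0, i) * hit m R l (0, i) ≤
        hit m (fun P Q => R P Q ∧ (P, Q) ∉ E) l (0, i) * hit m R k (0, i) := by
    intro E
    induction E using Finset.induction_on with
    | empty =>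
      intro _
      simp only [Finset.notMem_empty, not_false_eq_true, and_true]
      rw [mul_comm]
    | insert e E _ ih =>
      intro hE
      set R₁ : ℤ × ℤ → ℤ × ℤ → Prop := fun P Q => R P Q ∧ (P, Q) ∉ E with hR₁
      set R₂ : ℤ × ℤ → ℤ × ℤ → Prop := fun P Q => R P Q ∧ (P, Q) ∉ insert e E with hR₂
      have h1R : ∀ P Q, R₁ P Q → R P Q := fun _ _ h => h.1
      have h21 : ∀ P Q, R₂ P Q → R₁ P Q := fun _ _ h => ⟨h.1, fun h' => h.2 (by simp [h'])⟩
      have hstep := hit_mul_hit_le_of_remove_edge (R := R₁) (R' := R₂) (P := e.1) (Q := e.2) hm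
        (hR.mono h1R) hlk ((hE e (Finset.mem_insert_self _ _)).anti h1R) (by
          intro A B
          simp only [hR₁, hR₂, Finset.mem_insert, not_or, ne_eq, Prod.mk.eta]
          tauto)
      exact likelihood_ratio_trans (hit_nonneg _) (hit_nonneg _) (hit_nonneg _) (hit_nonneg _)
        (hit_nonneg _) (.inl (hit_mono h21 _)) hstep
        (ih fun e' he' => hE e' (Finset.mem_insert_of_mem he'))
  obtain ⟨B, hB⟩ := hR.bounded
  have hfin : {e : (ℤ × ℤ) × (ℤ × ℤ) | R e.1 e.2 ∧ ¬ R' e.1 e.2}.Finite := by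
    refine (Set.finite_Icc (((0 : ℤ), -B - 1), ((0 : ℤ), -B - 1))
      (((m : ℤ), B + 1), ((m : ℤ), B + 1))).subset ?_
    rintro ⟨P, Q⟩ ⟨h, -⟩
    simp only at h
    have h1 := abs_le.1 (hB h)
    have h2 := hR.source_nonneg h
    have h3 := hR.source_lt h
    have h4 := hR.target_nonneg h
    have h5 := hR.target_le h
    obtain ⟨x, y, ⟨rfl, rfl⟩ | ⟨rfl, rfl⟩ | ⟨rfl, rfl⟩ | ⟨rfl, rfl⟩⟩ := hR.exists_direction h <;>
      simp only [Set.mem_Icc, Prod.mk_le_mk] at * <;> omega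
  have h := hind hfin.toFinset (fun e he => by
    have := (Set.Finite.mem_toFinset hfin).1 he
    exact hab _ _ this.1 this.2)
  have heq : (fun P Q => R P Q ∧ (P, Q) ∉ hfin.toFinset) = R' := by
    funext P Q
    refine propext ?_
    simp only [Set.Finite.mem_toFinset, Set.mem_ofPred_eq, not_and, not_not]
    exact ⟨fun h => h.2 h.1, fun h => ⟨hle _ _ h, fun _ => h⟩⟩
  rwa [heq] at h

end Comparison

/-! ### Reflections and translations in the vertical direction -/

/-- The map `(x, y) ↦ (x, ε y + c)`, a symmetry of the walk if `ε = 1` or `ε = -1`. -/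
def vert (ε c : ℤ) (z : ℤ × ℤ) : ℤ × ℤ := (z.1, ε * z.2 + c)

lemma hit_vert {m : ℕ} {R R' : ℤ × ℤ → ℤ × ℤ → Prop} {ε c : ℤ} (hε : ε = 1 ∨ ε = -1)
    (hRR' : ∀ P Q, R' P Q ↔ R (vert ε c P) (vert ε c Q)) (k : ℤ) (z : ℤ × ℤ) :
    hit m R' k z = hit m R (ε * k + c) (vert ε c z) := by
  classical
  have hpt : ∀ z : ℤ × ℤ, vert ε c z = ((m : ℤ), ε * k + c) ↔ z = ((m : ℤ), k) := by
    rintro ⟨x, y⟩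
    simp only [vert, Prod.mk.injEq, add_left_inj]
    rcases hε with rfl | rfl <;> simp
  have key : ∀ n z, hitWithin m R' k n z = hitWithin m R (ε * k + c) n (vert ε c z) := by
    intro n
    induction n with
    | zero => intro z; simp only [hitWithin, hpt]
    | succ n ih =>
      intro z
      have h1 : (vert ε c z).1 = z.1 := rfl
      simp only [hitWithin, hpt, h1]
      split_ifs
      · rfl
      · rfl
      · rw [avg, avg]
        congr 1
        refine Finset.sum_nbij' (fun e => (e.1, ε * e.2)) (fun e => (e.1, ε * e.2)) ?_ ?_ ?_ ?_ ?_
        · rcases hε with rfl | rfl <;> decide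
        · rcases hε with rfl | rfl <;> decide
        · rcases hε with rfl | rfl <;> simp
        · rcases hε with rfl | rfl <;> simp
        · intro e _
          have h2 : vert ε c z + (e.1, ε * e.2) = vert ε c (z + e) := by
            simp only [vert, Prod.fst_add, Prod.snd_add, Prod.mk_add_mk, Prod.mk.injEq, true_and]
            ring
          rw [h2, ih, hRR']
  simp only [hit, key]

/-! ### Bands and their vertical shifts -/

/-- The part of the strip `0 ≤ x ≤ m` between a lower and an upper boundary. The boundaries are
given by the (upward closed) sets of points `lo` and of horizontal unit segments `hlo` that are on
or above the lower one, and the (downward closed) sets `hi` and `hhi` of those that are on or below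
the upper one; a segment is named by its left endpoint. -/
structure Band (m : ℕ) where
  lo : ℤ → ℤ → Prop
  hi : ℤ → ℤ → Prop
  hlo : ℤ → ℤ → Prop
  hhi : ℤ → ℤ → Prop
  lo_mono : ∀ {x j j'}, j ≤ j' → lo x j → lo x j'
  hi_anti : ∀ {x j j'}, j ≤ j' → hi x j' → hi x j
  hlo_mono : ∀ {x j j'}, j ≤ j' → hlo x j → hlo x j'
  hhi_anti : ∀ {x j j'}, j ≤ j' → hhi x j' → hhi x j
  lo_of_hlo : ∀ {x j}, hlo x j → lo x j ∧ lo (x + 1) j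
  hi_of_hhi : ∀ {x j}, hhi x j → hi x j ∧ hi (x + 1) j
  bounded : ∃ B : ℤ, ∀ x j, lo x j → hi x j → |j| ≤ B

namespace Band

variable {m : ℕ}

/-- The vertical unit segments of the band, traversed in either direction. Those on the line `x = m`
are left out. -/
def Vertical (G : Band m) (P Q : ℤ × ℤ) : Prop :=
  0 ≤ P.1 ∧ P.1 < m ∧ P.1 = Q.1 ∧ |P.2 - Q.2| = 1 ∧
    (G.lo P.1 P.2 ∧ G.hi P.1 P.2) ∧ (G.lo Q.1 Q.2 ∧ G.hi Q.1 Q.2)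

/-- The horizontal unit segments of the band, traversed in either direction, except for steps from
the line `x = m` to the left. -/
def Horizontal (G : Band m) (P Q : ℤ × ℤ) : Prop :=
  (0 ≤ P.1 ∧ P.1 < m ∧ 0 ≤ Q.1 ∧ Q.1 ≤ m) ∧ P.2 = Q.2 ∧ |P.1 - Q.1| = 1 ∧
    G.hlo (min P.1 Q.1) P.2 ∧ G.hhi (min P.1 Q.1) P.2

/-- The graph of the band, without the steps that start on the line `x = m`. -/
def Edge (G : Band m) (P Q : ℤ × ℤ) : Prop := G.Vertical P Q ∨ G.Horizontal P Q

/-- The graph of the union of the band and its translate by `(0, 1)`. -/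
def EdgeUnion (G : Band m) (P Q : ℤ × ℤ) : Prop :=
  G.Edge P Q ∨ G.Edge (vert 1 (-1) P) (vert 1 (-1) Q)

/-- The union of a band and its translate by `(0, 1)`, without the horizontal segments of
the translate alone. -/
def EdgeVerticalUnion (G : Band m) (P Q : ℤ × ℤ) : Prop :=
  G.Edge P Q ∨ G.Vertical (vert 1 (-1) P) (vert 1 (-1) Q)

lemma points_of_horizontal (G : Band m) {P Q : ℤ × ℤ} (h : G.Horizontal P Q) :
    (G.lo P.1 P.2 ∧ G.hi P.1 P.2) ∧ (G.lo Q.1 Q.2 ∧ G.hi Q.1 Q.2) := by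
  obtain ⟨-, h2, h1, hlo, hhi⟩ := h
  have hlo' := G.lo_of_hlo hlo
  have hhi' := G.hi_of_hhi hhi
  rw [← h2]
  rcases abs_eq (zero_le_one) |>.1 h1 with h | h
  · have e : min P.1 Q.1 = Q.1 := by omega
    rw [e, ← show P.1 = Q.1 + 1 by omega] at hlo' hhi'
    exact ⟨⟨hlo'.2, hhi'.2⟩, hlo'.1, hhi'.1⟩
  · have e : min P.1 Q.1 = P.1 := by omega
    rw [e, ← show Q.1 = P.1 + 1 by omega] at hlo' hhi'
    exact ⟨⟨hlo'.1, hhi'.1⟩, hlo'.2, hhi'.2⟩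

lemma isStripGraph_edge (G : Band m) : IsStripGraph m G.Edge := by
  obtain ⟨B, hB⟩ := G.bounded
  refine ⟨?_, ?_, ?_, ?_, ?_, B, ?_⟩
  · rintro P Q (⟨h1, h2, h3, h4, -⟩ | ⟨-, h1, h2, -⟩)
    · simp [NearestNeighbor, h3, h4]
    · simp [NearestNeighbor, h1, h2]
  · rintro P Q (h | h)
    exacts [h.1, h.1.1]
  · rintro P Q (h | h)
    exacts [h.2.1, h.1.2.1]
  · rintro P Q (⟨h1, h2, h3, -⟩ | h)
    exacts [h3 ▸ h1, h.1.2.2.1]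
  · rintro P Q (⟨h1, h2, h3, -⟩ | h)
    exacts [h3 ▸ h2.le, h.1.2.2.2]
  · rintro P Q (h | h)
    · exact hB _ _ h.2.2.2.2.2.1 h.2.2.2.2.2.2
    · exact hB _ _ (G.points_of_horizontal h).2.1 (G.points_of_horizontal h).2.2

lemma isStripGraph_edgeUnion (G : Band m) : IsStripGraph m G.EdgeUnion := by
  have h := G.isStripGraph_edge
  obtain ⟨B, hB⟩ := h.bounded
  refine ⟨?_, ?_, ?_, ?_, ?_, B + 1, ?_⟩
  · rintro P Q (e | e)
    · exact h.nearest e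
    · simpa [NearestNeighbor, vert] using h.nearest e
  · rintro P Q (e | e)
    exacts [h.source_nonneg e, h.source_nonneg (P := vert 1 (-1) P) e]
  · rintro P Q (e | e)
    exacts [h.source_lt e, h.source_lt (P := vert 1 (-1) P) e]
  · rintro P Q (e | e)
    exacts [h.target_nonneg e, h.target_nonneg (Q := vert 1 (-1) Q) e]
  · rintro P Q (e | e)
    exacts [h.target_le e, h.target_le (Q := vert 1 (-1) Q) e]
  · rintro P Q (e | e)
    · exact (hB e).trans (by simp)
    · have := abs_le.1 (hB e)
      simp only [vert] at this
      exact abs_le.2 (by omega)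

/-- Enlarging a band to its union with its translate by `(0, 1)` raises the hitting distributions
from the line `x = 0` in the likelihood ratio order. All the edges that are added lie at the upper
boundary. The removal of the horizontal ones goes first, so that the targets of the vertical ones
are not below any of the remaining horizontal edges. -/
lemma hit_mul_hit_le_edgeUnion (hm : 0 < m) (G : Band m) {i k l : ℤ} (hlk : l < k) :
    hit m G.Edge k (0, i) * hit m G.EdgeUnion l (0, i) ≤
      hit m G.Edge l (0, i) * hit m G.EdgeUnion k (0, i) := by
  have hU := G.isStripGraph_edgeUnion
  have hEV : ∀ P Q, G.Edge P Q → G.EdgeVerticalUnion P Q := fun _ _ => Or.inl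
  have hVU : ∀ P Q, G.EdgeVerticalUnion P Q → G.EdgeUnion P Q :=
    fun _ _ h => h.imp_right Or.inl
  have hV := hU.mono hVU
  have hhor : ∀ x y, G.Horizontal (x, y) (x + 1, y) ∨ G.Horizontal (x + 1, y) (x, y) →
      G.hhi x y := by
    rintro x y (h | h) <;> simpa using h.2.2.2.2
  have hnv : ∀ x y, ¬ G.Vertical (x, y) (x + 1, y) ∧ ¬ G.Vertical (x + 1, y) (x, y) :=
    fun x y => ⟨fun h => by simpa using h.2.2.1, fun h => by simpa using h.2.2.1⟩
  -- The horizontal edges.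
  have h1 : hit m G.EdgeVerticalUnion k (0, i) * hit m G.EdgeUnion l (0, i) ≤
      hit m G.EdgeVerticalUnion l (0, i) * hit m G.EdgeUnion k (0, i) := by
    refine hit_mul_hit_le_of_le hm hU hlk hVU fun P Q hPQ hnot => ?_
    have hnE : ¬ G.Horizontal P Q := fun h => hnot (.inl (.inr h))
    have hS : G.Horizontal (vert 1 (-1) P) (vert 1 (-1) Q) := by
      rcases hPQ with h | h | h
      · exact absurd (.inl h) hnot
      · exact absurd (.inr h) hnot
      · exact h
    obtain ⟨hx, h2, habs, hlo, hhi⟩ := hS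
    simp only [vert, one_mul, add_left_inj] at hx h2 habs hlo hhi
    have hnhi : ¬ G.hhi (min P.1 Q.1) P.2 := fun h =>
      hnE ⟨hx, h2, habs, G.hlo_mono (by omega) hlo, h⟩
    have htop : ∀ y, G.EdgeUnion (min P.1 Q.1, y) (min P.1 Q.1 + 1, y) ∨
        G.EdgeUnion (min P.1 Q.1 + 1, y) (min P.1 Q.1, y) → y ≤ Q.2 := by
      intro y hy
      have : G.hhi (min P.1 Q.1) (y + -1) := by
        rcases hy with ((h | h) | (h | h)) | ((h | h) | (h | h))
        · exact absurd h (hnv _ _).1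
        · exact G.hhi_anti (by omega) (hhor _ _ (.inl h))
        · exact absurd h (by simpa [vert] using (hnv _ (y + -1)).1)
        · exact hhor _ _ (.inl (by simpa [vert] using h))
        · exact absurd h (hnv _ _).2
        · exact G.hhi_anti (by omega) (hhor _ _ (.inr h))
        · exact absurd h (by simpa [vert] using (hnv _ (y + -1)).2)
        · exact hhor _ _ (.inr (by simpa [vert] using h))
      by_contra! hlt
      exact hnhi (G.hhi_anti (by omega) this)
    rcases abs_eq (zero_le_one) |>.1 habs with h | h
    · have e : min P.1 Q.1 = Q.1 := by omega
      rw [e] at htop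
      exact .inl ⟨by omega, htop⟩
    · have e : min P.1 Q.1 = Q.1 - 1 := by omega
      rw [e, sub_add_cancel] at htop
      exact .inr ⟨.inl (by omega), htop⟩
  -- The vertical edges.
  have h2 : hit m G.Edge k (0, i) * hit m G.EdgeVerticalUnion l (0, i) ≤
      hit m G.Edge l (0, i) * hit m G.EdgeVerticalUnion k (0, i) := by
    refine hit_mul_hit_le_of_le hm hV hlk hEV fun P Q hPQ hnot => ?_
    obtain ⟨hx0, hxm, h1, habs, hP, hQ⟩ := hPQ.resolve_left hnot
    simp only [vert, one_mul] at hx0 hxm h1 habs hP hQ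
    have habs' : |P.2 - Q.2| = 1 := by simpa using habs
    refine .inl ⟨h1 ▸ hxm, fun y hy => ?_⟩
    have hy' : G.hhi Q.1 y := by
      rcases hy with ((h | h) | h) | ((h | h) | h)
      · exact absurd h (hnv _ _).1
      · exact hhor _ _ (.inl h)
      · exact absurd h (by simpa [vert] using (hnv _ (y + -1)).1)
      · exact absurd h (hnv _ _).2
      · exact hhor _ _ (.inr h)
      · exact absurd h (by simpa [vert] using (hnv _ (y + -1)).2)
    have hy2 := (G.hi_of_hhi hy').1
    by_contra! hlt
    -- Otherwise both ends of the edge would be in the band.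
    have hle := abs_le.1 habs'.le
    refine hnot (.inl ⟨hx0, hxm, h1, habs', ⟨G.lo_mono (by omega) hP.1, ?_⟩,
      ⟨G.lo_mono (by omega) hQ.1, G.hi_anti hlt.le hy2⟩⟩)
    rw [h1]
    exact G.hi_anti (by omega) hy2
  exact likelihood_ratio_trans (hit_nonneg _) (hit_nonneg _) (hit_nonneg _) (hit_nonneg _)
    (hit_nonneg _) (.inl (hit_mono hEV _)) h2 h1

/-- The mirror image of a band under `(x, y) ↦ (x, -y)`. -/
def reflect (G : Band m) : Band m where
  lo x j := G.hi x (-j)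
  hi x j := G.lo x (-j)
  hlo x j := G.hhi x (-j)
  hhi x j := G.hlo x (-j)
  lo_mono h := G.hi_anti (neg_le_neg h)
  hi_anti h := G.lo_mono (neg_le_neg h)
  hlo_mono h := G.hhi_anti (neg_le_neg h)
  hhi_anti h := G.hlo_mono (neg_le_neg h)
  lo_of_hlo := G.hi_of_hhi
  hi_of_hhi := G.lo_of_hlo
  bounded := by
    obtain ⟨B, hB⟩ := G.bounded
    exact ⟨B, fun x j h1 h2 => by simpa using hB x (-j) h2 h1⟩

lemma edge_reflect (G : Band m) (P Q : ℤ × ℤ) :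
    G.reflect.Edge P Q ↔ G.Edge (vert (-1) 0 P) (vert (-1) 0 Q) := by
  have h : |-P.2 - -Q.2| = |P.2 - Q.2| := by
    rw [← abs_neg]
    congr 1
    ring
  simp only [Edge, Vertical, Horizontal, reflect, vert, neg_mul, one_mul, add_zero, h, neg_inj]
  tauto

/-- The hitting distribution on the line `x = m` of the walk in a band, started on the line `x = 0`,
is log-concave: it is dominated in the likelihood ratio order by its translate by `(0, 1)`, as one
sees by passing through the union of the band and its translate. -/
theorem hit_mul_hit_le_sq (hm : 0 < m) (G : Band m) (k : ℤ) :
    hit m G.Edge (k + 1) (0, 0) * hit m G.Edge (k - 1) (0, 0) ≤ hit m G.Edge k (0, 0) ^ 2 := by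
  set S : ℤ × ℤ → ℤ × ℤ → Prop := fun P Q => G.Edge (vert 1 (-1) P) (vert 1 (-1) Q) with hS
  have hSU : ∀ P Q, S P Q → G.EdgeUnion P Q := fun _ _ => Or.inr
  have hEU : ∀ P Q, G.Edge P Q → G.EdgeUnion P Q := fun _ _ => Or.inl
  have hU := G.isStripGraph_edgeUnion
  have hlk : k < k + 1 := lt_add_one k
  have hshift : ∀ j, hit m S (j + 1) (0, 1) = hit m G.Edge j (0, 0) := by
    intro j
    rw [hit_vert (R := G.Edge) (.inl rfl) (fun P Q => Iff.rfl)]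
    simp [vert]
  have h1 := G.hit_mul_hit_le_edgeUnion hm (i := 0) hlk
  have h2 : hit m G.EdgeUnion (k + 1) (0, 0) * hit m G.EdgeUnion k (0, 1) ≤
      hit m G.EdgeUnion k (0, 0) * hit m G.EdgeUnion (k + 1) (0, 1) := by
    refine hit_mul_hit_le_of_isAbove hm hU hlk (.inr ⟨.inr zero_lt_one, ?_⟩)
    rintro y (h | h)
    · have := hU.source_nonneg h
      simp at this
    · have := hU.target_nonneg h
      simp at this
  have h3 : hit m G.EdgeUnion (k + 1) (0, 1) * hit m S k (0, 1) ≤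
      hit m G.EdgeUnion k (0, 1) * hit m S (k + 1) (0, 1) := by
    -- The reflection `y ↦ 1 - y` maps `G.reflect` to the translate of `G`, and the union formed
    -- from `G.reflect` to the one formed from `G`.
    have hv0 : ∀ P, vert (-1) 0 P = vert 1 (-1) (vert (-1) 1 P) := by
      intro P; simp [vert]
    have hv1 : ∀ P, vert (-1) 0 (vert 1 (-1) P) = vert (-1) 1 P := by
      intro P; simp [vert, add_comm]
    have hE : ∀ P Q, G.reflect.Edge P Q ↔ S (vert (-1) 1 P) (vert (-1) 1 Q) := by
      intro P Q
      rw [edge_reflect, hv0, hv0]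
    have hEU' : ∀ P Q, G.reflect.EdgeUnion P Q ↔
        G.EdgeUnion (vert (-1) 1 P) (vert (-1) 1 Q) := by
      intro P Q
      rw [EdgeUnion, hE, edge_reflect, hv1, hv1, or_comm]
      rfl
    have h := G.reflect.hit_mul_hit_le_edgeUnion hm (i := 0) 
      (show -(k + 1) + 1 < -k + 1 by omega)
    rw [hit_vert (.inr rfl) hE, hit_vert (.inr rfl) hE, hit_vert (.inr rfl) hEU',
      hit_vert (.inr rfl) hEU'] at h
    have e1 : (-1 : ℤ) * (-k + 1) + 1 = k := by ring
    have e2 : (-1 : ℤ) * (-(k + 1) + 1) + 1 = k + 1 := by ring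
    have e3 : vert (-1) 1 (0, 0) = (0, 1) := rfl
    rw [e1, e2, e3] at h
    linarith
  have h12 : hit m G.Edge (k + 1) (0, 0) * hit m G.EdgeUnion k (0, 1) ≤
      hit m G.Edge k (0, 0) * hit m G.EdgeUnion (k + 1) (0, 1) :=
    likelihood_ratio_trans (hit_nonneg _) (hit_nonneg _) (hit_nonneg _) (hit_nonneg _)
      (hit_nonneg _) (.inl (hit_mono hEU _)) h1 h2
  have h := likelihood_ratio_trans (hit_nonneg _) (hit_nonneg _) (hit_nonneg _) (hit_nonneg _)
    (hit_nonneg _) (.inr (hit_mono hSU _)) h12 h3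
  have e := hshift (k - 1)
  rw [sub_add_cancel] at e
  rwa [hshift, e, ← sq] at h

end Band

/-! ### The hitting probability of the random walk -/

section Probability

variable {m : ℕ} {R : ℤ × ℤ → ℤ × ℤ → Prop} {k : ℤ}

/-- The walk on `R` that is at `z` at time `s` and has increments `x s, x (s + 1), …` reaches
`(m, k)` within `n` steps. -/
def ReachesWithin (m : ℕ) (R : ℤ × ℤ → ℤ × ℤ → Prop) (k : ℤ) (x : ℕ → ℤ × ℤ) :
    ℕ → ℕ → ℤ × ℤ → Prop
  | 0, _, z => z = ((m : ℤ), k)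
  | n + 1, s, z => z = ((m : ℤ), k) ∨ R z (z + x s) ∧ ReachesWithin m R k x n (s + 1) (z + x s)

lemma ReachesWithin.succ {x : ℕ → ℤ × ℤ} {n s : ℕ} {z : ℤ × ℤ}
    (h : ReachesWithin m R k x n s z) : ReachesWithin m R k x (n + 1) s z := by
  induction n generalizing s z with
  | zero => exact .inl h
  | succ n ih => exact h.imp_right fun h => ⟨h.1, ih h.2⟩

lemma reachesWithin_eq_biUnion {Ω : Type*} {ξ : ℕ → Ω → ℤ × ℤ} (hR : IsStripGraph m R)
    (n s : ℕ) {z : ℤ × ℤ}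
    (hz : z ≠ ((m : ℤ), k)) :
    {ω | ReachesWithin m R k (fun t => ξ t ω) (n + 1) s z} =
      ⋃ e ∈ unitSteps, ξ s ⁻¹' {e} ∩
        {ω | R z (z + e) ∧ ReachesWithin m R k (fun t => ξ t ω) n (s + 1) (z + e)} := by
  ext ω
  simp only [Set.mem_ofPred_eq, ReachesWithin, hz, false_or, Set.mem_iUnion, Set.mem_inter_iff,
    Set.mem_preimage, Set.mem_singleton_iff, exists_prop]
  constructor
  · intro h
    refine ⟨ξ s ω, ?_, rfl, h⟩
    have := mem_unitSteps_of_nearestNeighbor (hR.nearest h.1)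
    rwa [add_sub_cancel_left] at this
  · rintro ⟨e, -, rfl, h⟩
    exact h

lemma measurableSet_reachesWithin {Ω : Type*} {ξ : ℕ → Ω → ℤ × ℤ} (hR : IsStripGraph m R)
    (n s : ℕ) (z : ℤ × ℤ) :
    MeasurableSet[⨆ j ∈ Set.Ici s, MeasurableSpace.comap (ξ j) inferInstance]
      {ω | ReachesWithin m R k (fun t => ξ t ω) n s z} := by
  induction n generalizing s z with
  | zero => exact MeasurableSet.const _
  | succ n ih =>
    by_cases hz : z = ((m : ℤ), k)
    · simp only [ReachesWithin, hz, true_or]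
      exact MeasurableSet.const _
    rw [reachesWithin_eq_biUnion hR n s hz]
    refine Finset.measurableSet_biUnion _ fun e _ => ?_
    refine MeasurableSet.inter ?_ ?_
    · exact (le_iSup₂ (f := fun j (_ : j ∈ Set.Ici s) =>
        MeasurableSpace.comap (ξ j) inferInstance) s Set.self_mem_Ici) _
          ⟨{e}, measurableSet_singleton e, rfl⟩
    · rw [Set.ofPred_and]
      refine MeasurableSet.inter (MeasurableSet.const _) ?_
      exact (iSup₂_mono' fun j hj => ⟨j, (Nat.le_succ s).trans hj, le_rfl⟩ :
        (⨆ j ∈ Set.Ici (s + 1), MeasurableSpace.comap (ξ j) inferInstance) ≤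
          ⨆ j ∈ Set.Ici s, MeasurableSpace.comap (ξ j) inferInstance) _ (ih (s + 1) (z + e))

variable {Ω : Type*} [MeasurableSpace Ω] {μ : Measure Ω} [IsProbabilityMeasure μ]
  {ξ : ℕ → Ω → ℤ × ℤ}

lemma measureReal_reachesWithin (hR : IsStripGraph m R) (hξ : IsSimpleWalkIncrements μ ξ)
    (n s : ℕ) (z : ℤ × ℤ) :
    μ.real {ω | ReachesWithin m R k (fun t => ξ t ω) n s z} = hitWithin m R k n z := by
  classical
  induction n generalizing s z with
  | zero =>
    simp only [ReachesWithin, hitWithin]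
    split_ifs with hz <;> simp [hz]
  | succ n ih =>
    by_cases hz : z = ((m : ℤ), k)
    · simp [ReachesWithin, hitWithin, hz]
    have hle : ∀ S : Set ℕ, (⨆ j ∈ S, MeasurableSpace.comap (ξ j) inferInstance) ≤
        (inferInstance : MeasurableSpace Ω) := fun S =>
      iSup₂_le fun j _ => (hξ.measurable j).comap_le
    have hmeas : ∀ e, MeasurableSet {ω | R z (z + e) ∧
        ReachesWithin m R k (fun t => ξ t ω) n (s + 1) (z + e)} := by
      intro e
      rw [Set.ofPred_and]
      exact (MeasurableSet.const _).inter (hle _ _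
        (measurableSet_reachesWithin hR n (s + 1) (z + e)))
    rw [reachesWithin_eq_biUnion hR n s hz, measureReal_biUnion_finset]
    · have hterm : ∀ e ∈ unitSteps, μ.real (ξ s ⁻¹' {e} ∩
          {ω | R z (z + e) ∧ ReachesWithin m R k (fun t => ξ t ω) n (s + 1) (z + e)}) =
          (if R z (z + e) then hitWithin m R k n (z + e) else 0) / 4 := by
        intro e he
        split_ifs with hRe
        · simp only [hRe, true_and]
          have hind := indep_iSup_of_disjoint (fun j => (hξ.measurable j).comap_le) hξ.indep.iIndep
            (S := {s}) (T := Set.Ici (s + 1)) (by simp)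
          have h := (Indep_iff _ _ μ).1 hind (ξ s ⁻¹' {e}) _
            (by
              rw [iSup_singleton]
              exact ⟨{e}, measurableSet_singleton e, rfl⟩)
            (measurableSet_reachesWithin (k := k) hR n (s + 1) (z + e))
          rw [measureReal_def, h, ENNReal.toReal_mul,
            hξ.uniform s e (nearestNeighbor_of_mem_unitSteps he), ← measureReal_def, ih]
          simp
          ring
        · simp [hRe]
      rw [Finset.sum_congr rfl hterm, ← Finset.sum_div]
      by_cases hzm : z.1 = m
      · rw [hitWithin, if_pos hzm, if_neg hz, Finset.sum_eq_zero, zero_div]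
        intro e _
        rw [if_neg]
        exact fun h => (hR.source_lt h).ne hzm
      · rw [hitWithin, if_neg hzm, avg]
    · intro e _ e' _ hne
      refine Set.disjoint_left.2 ?_
      rintro ω ⟨h, -⟩ ⟨h', -⟩
      exact hne (h.symm.trans h')
    · intro e _
      exact (hξ.measurable s (measurableSet_singleton e)).inter (hmeas e)

lemma measureReal_exists_reachesWithin (hR : IsStripGraph m R) (hξ : IsSimpleWalkIncrements μ ξ)
    (z : ℤ × ℤ) :
    μ.real {ω | ∃ n, ReachesWithin m R k (fun t => ξ t ω) n 0 z} = hit m R k z := by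
  have hmono : Monotone fun n => {ω | ReachesWithin m R k (fun t => ξ t ω) n 0 z} :=
    monotone_nat_of_le_succ fun n ω h => ReachesWithin.succ h
  have h := (ENNReal.tendsto_toReal (measure_ne_top μ _)).comp
    (tendsto_measure_iUnion_atTop (μ := μ) hmono)
  refine tendsto_nhds_unique ?_ (tendsto_hitWithin z)
  simp only [← measureReal_reachesWithin (k := k) hR hξ _ 0 z]
  rw [Set.ofPred_exists]
  exact h

lemma ae_mem_unitSteps (hξ : IsSimpleWalkIncrements μ ξ) : ∀ᵐ ω ∂μ, ∀ t, ξ t ω ∈ unitSteps := by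
  refine ae_all_iff.2 fun t => ?_
  have hmeas : ∀ e, MeasurableSet (ξ t ⁻¹' {e}) := fun e =>
    hξ.measurable t (measurableSet_singleton e)
  have heq : {ω | ξ t ω ∈ unitSteps} = ⋃ e ∈ unitSteps, ξ t ⁻¹' {e} := by
    ext ω
    simp
  have hms : MeasurableSet {ω | ξ t ω ∈ unitSteps} := by
    rw [heq]
    exact Finset.measurableSet_biUnion _ fun e _ => hmeas e
  refine (mem_ae_iff_prob_eq_one hms).2 ?_
  rw [heq, measure_biUnion_finset _ fun e _ => hmeas e]
  · rw [Finset.sum_congr rfl fun e he => hξ.uniform t e (nearestNeighbor_of_mem_unitSteps he),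
      Finset.sum_const, card_unitSteps, nsmul_eq_mul]
    exact ENNReal.mul_div_cancel (by norm_num) (by norm_num)
  · intro e _ e' _ hne
    refine Set.disjoint_left.2 ?_
    rintro ω h h'
    exact hne (h.symm.trans h')

end Probability

end StripWalk

/-! ### The region between two lattice paths -/

namespace LatticePath

lemma XMonotone.le {η : LatticePath} (h : η.XMonotone) {s t : ℕ} (hst : s ≤ t) (ht : t ≤ η.len) :
    (η.pt s).1 ≤ (η.pt t).1 := by
  induction t, hst using Nat.le_induction with
  | base => exact le_rfl
  | succ t _ ih => exact (ih (by omega)).trans (h t (by omega))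

lemma exists_bound (η : LatticePath) : ∃ B : ℤ, ∀ P, η.Visits P → |P.2| ≤ B := by
  refine ⟨∑ s ∈ Finset.range (η.len + 1), |(η.pt s).2|, ?_⟩
  rintro P ⟨s, hs, rfl⟩
  exact Finset.single_le_sum (f := fun s => |(η.pt s).2|) (fun _ _ => abs_nonneg _)
    (Finset.mem_range.2 (Nat.lt_succ_of_le hs))

lemma HasHorizontalStep.visits {η : LatticePath} {i y : ℤ} (h : η.HasHorizontalStep i y) :
    η.Visits (i, y) ∧ η.Visits (i + 1, y) := by
  obtain ⟨s, hs, h1, h2⟩ := h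
  exact ⟨⟨s, hs.le, h1⟩, ⟨s + 1, hs, h2⟩⟩

end LatticePath

namespace LatticeRegion

open StripWalk

variable {m : ℕ} (Γ : LatticeRegion m)

/-- The region as a part of the strip `0 ≤ x ≤ m` between two boundaries. -/
def band : Band m where
  lo x j := ∃ y : ℤ, y ≤ j ∧ Γ.lower.Visits (x, y)
  hi x j := ∃ y : ℤ, j ≤ y ∧ Γ.upper.Visits (x, y)
  hlo x j := ∃ y : ℤ, y ≤ j ∧ Γ.lower.HasHorizontalStep x y
  hhi x j := ∃ y : ℤ, j ≤ y ∧ Γ.upper.HasHorizontalStep x y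
  lo_mono h := fun ⟨y, hy, h'⟩ => ⟨y, hy.trans h, h'⟩
  hi_anti h := fun ⟨y, hy, h'⟩ => ⟨y, h.trans hy, h'⟩
  hlo_mono h := fun ⟨y, hy, h'⟩ => ⟨y, hy.trans h, h'⟩
  hhi_anti h := fun ⟨y, hy, h'⟩ => ⟨y, h.trans hy, h'⟩
  lo_of_hlo := fun ⟨y, hy, h'⟩ => ⟨⟨y, hy, h'.visits.1⟩, ⟨y, hy, h'.visits.2⟩⟩
  hi_of_hhi := fun ⟨y, hy, h'⟩ => ⟨⟨y, hy, h'.visits.1⟩, ⟨y, hy, h'.visits.2⟩⟩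
  bounded := by
    obtain ⟨B, hB⟩ := Γ.lower.exists_bound
    obtain ⟨C, hC⟩ := Γ.upper.exists_bound
    refine ⟨max B C, ?_⟩
    rintro x j ⟨y, hy, h⟩ ⟨y', hy', h'⟩
    have h1 := abs_le.1 (hB _ h)
    have h2 := abs_le.1 (hC _ h')
    simp only at h1 h2
    exact abs_le.2 (by omega)

lemma fst_mem_of_mem_points {P : ℤ × ℤ} (h : P ∈ Γ.points) : 0 ≤ P.1 ∧ P.1 ≤ m := by
  obtain ⟨⟨y, -, s, hs, he⟩, -⟩ := h
  have h1 := Γ.lower_mono.le (Nat.zero_le s) hs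
  have h2 := Γ.lower_mono.le hs le_rfl
  rw [he, Γ.lower_start] at h1
  rw [he, Γ.lower_end] at h2
  exact ⟨h1, h2⟩

lemma edge_band_iff {P Q : ℤ × ℤ} :
    Γ.band.Edge P Q ↔ NearestNeighbor P Q ∧ P.1 ≠ m ∧ Γ.StepInside P Q := by
  constructor
  · intro h
    refine ⟨Γ.band.isStripGraph_edge.nearest h, (Γ.band.isStripGraph_edge.source_lt h).ne, ?_⟩
    rcases h with h | h
    · exact ⟨h.2.2.2.2.1, h.2.2.2.2.2, fun hne => absurd h.2.2.1 hne⟩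
    · obtain ⟨hP, hQ⟩ := Γ.band.points_of_horizontal h
      exact ⟨hP, hQ, fun _ => h.2.2.2⟩
  · rintro ⟨hnn, hm, hP, hQ, hhor⟩
    have h1 := Γ.fst_mem_of_mem_points hP
    have h2 := Γ.fst_mem_of_mem_points hQ
    have hlt : P.1 < m := lt_of_le_of_ne h1.2 hm
    rw [NearestNeighbor] at hnn
    by_cases h : P.1 = Q.1
    · left
      rw [h, sub_self, abs_zero, zero_add] at hnn
      exact ⟨h1.1, hlt, h, hnn, hP, hQ⟩
    · right
      have h3 : 1 ≤ |P.1 - Q.1| := Int.one_le_abs (sub_ne_zero.2 h)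
      have h4 := abs_nonneg (P.2 - Q.2)
      have h5 : |P.2 - Q.2| = 0 := by omega
      exact ⟨⟨h1.1, hlt, h2.1, h2.2⟩, sub_eq_zero.1 (abs_eq_zero.1 h5), by omega, hhor h⟩

variable {Γ}

lemma absorbedWalk_eq_none {x : ℕ → ℤ × ℤ} {s t : ℕ} (hst : s ≤ t)
    (h : Γ.absorbedWalk x s = none) : Γ.absorbedWalk x t = none := by
  induction t, hst using Nat.le_induction with
  | base => exact h
  | succ t _ ih => rw [absorbedWalk, ih]

/-- Along a sequence of unit steps, an absorbed walk that is at `z` at time `s` and has not been in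
`β` before first hits `β` at `(m, k)`, at time `s + n` at the latest, exactly when the walk on the
graph of the band reaches that point within `n` steps. -/
lemma reachesWithin_iff {x : ℕ → ℤ × ℤ} (hx : ∀ t, x t ∈ unitSteps) {k : ℤ} (n s : ℕ) (z : ℤ × ℤ)
    (hz : z ∈ Γ.points) (hs : Γ.absorbedWalk x s = some z) (hβ : ∀ t < s, ¬ Γ.InβAt x t) :
    ReachesWithin m Γ.band.Edge k x n s z ↔
      ∃ T ≤ s + n, Γ.IsFirstTime x T ∧ Γ.absorbedWalk x T = some ((m : ℤ), k) := by
  induction n generalizing s z with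
  | zero =>
    rw [ReachesWithin]
    constructor
    · rintro rfl
      exact ⟨s, le_rfl, ⟨⟨_, ⟨hz, rfl⟩, hs⟩, hβ⟩, hs⟩
    · rintro ⟨T, hTs, hT, hTk⟩
      obtain rfl : T = s := by
        by_contra hne
        exact hβ T (by omega) hT.1
      rw [hs] at hTk
      exact Option.some.inj hTk
  | succ n ih =>
    rw [ReachesWithin, edge_band_iff]
    by_cases hzm : z.1 = m
    · have hin : Γ.InβAt x s := ⟨z, ⟨hz, hzm⟩, hs⟩
      rw [or_iff_left fun h => h.1.2.1 hzm]
      constructor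
      · rintro rfl
        exact ⟨s, by omega, ⟨hin, hβ⟩, hs⟩
      · rintro ⟨T, -, hT, hTk⟩
        obtain rfl : T = s := by
          rcases lt_trichotomy T s with h | h | h
          exacts [absurd hT.1 (hβ T h), h, absurd hin (hT.2 s h)]
        rw [hs] at hTk
        exact Option.some.inj hTk
    have hβ' : ∀ t < s + 1, ¬ Γ.InβAt x t := by
      intro t ht
      rcases Nat.lt_succ_iff_lt_or_eq.1 ht with h | rfl
      · exact hβ t h
      · rintro ⟨P, hP, h⟩
        rw [hs] at h
        obtain rfl := Option.some.inj h
        exact hzm hP.2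
    have hzk : z ≠ ((m : ℤ), k) := fun h => hzm (by rw [h])
    rw [or_iff_right hzk]
    have hnn : NearestNeighbor z (z + x s) := by
      have := nearestNeighbor_of_mem_unitSteps (hx s)
      simpa [NearestNeighbor] using this
    by_cases hstep : Γ.StepInside z (z + x s)
    · have hs' : Γ.absorbedWalk x (s + 1) = some (z + x s) := by
        simp only [absorbedWalk, hs, if_pos hstep]
      rw [ih (s + 1) (z + x s) hstep.2.1 hs' hβ', and_iff_right ⟨hnn, hzm, hstep⟩,
        add_right_comm, add_assoc]
    · have hs' : Γ.absorbedWalk x (s + 1) = none := by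
        simp only [absorbedWalk, hs, if_neg hstep]
      refine iff_of_false (fun h => hstep h.1.2.2) ?_
      rintro ⟨T, -, hT, hTk⟩
      have hsT : s + 1 ≤ T := by
        by_contra! h
        exact hβ' T h hT.1
      rw [absorbedWalk_eq_none hsT hs'] at hTk
      exact absurd hTk (by simp)

end LatticeRegion

theorem theorem1p1 {m : ℕ} (hm : 0 < m) (Γ : LatticeRegion m) (hO : ((0 : ℤ), (0 : ℤ)) ∈ Γ.α)
    {Ω : Type*} [MeasurableSpace Ω] (μ : Measure Ω) [IsProbabilityMeasure μ]
    (ξ : ℕ → Ω → ℤ × ℤ) (hξ : IsSimpleWalkIncrements μ ξ)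
    (k : ℤ) (hk₁ : ((m : ℤ), k + 1) ∈ Γ.β) (hk₂ : ((m : ℤ), k - 1) ∈ Γ.β) :
    Γ.exitProb μ ξ k ^ 2 ≥ Γ.exitProb μ ξ (k + 1) * Γ.exitProb μ ξ (k - 1) := by
  have hexit : ∀ j, Γ.exitProb μ ξ j = StripWalk.hit m Γ.band.Edge j (0, 0) := by
    intro j
    rw [← StripWalk.measureReal_exists_reachesWithin Γ.band.isStripGraph_edge hξ,
      LatticeRegion.exitProb]
    refine measureReal_congr ?_
    filter_upwards [StripWalk.ae_mem_unitSteps hξ] with ω hω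
    refine propext ?_
    have h := fun n => LatticeRegion.reachesWithin_iff (k := j) hω n 0 (0, 0) hO.1 rfl (by simp)
    constructor
    · rintro ⟨T, hT⟩
      exact ⟨T, (h T).2 ⟨T, by simp, hT⟩⟩
    · rintro ⟨n, hn⟩
      obtain ⟨T, -, hT⟩ := (h n).1 hn
      exact ⟨T, hT⟩
  rw [hexit, hexit, hexit]
  exact Γ.band.hit_mul_hit_le_sq hm k
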